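/- Let $v : K \to G\cup\{\infty\}$ be a Krull valuation of a field $K$, written additively, where $G$ is a totally ordered abelian group; let $G_v = v(K^\times)$ be its value group, $R_v$ its valuation ring and $M_v$ the maximal ideal of $R_v$. For a polynomial $p=\sum_i c_i x^i \in K[x]$ put $v^x(p)=\min_i v(c_i)$, with $v^x(0)=\infty$. Let $\phi\in R_v[x]$ be a monic polynomial of degree $m$ whose reduction modulo $M_v$ is irreducible over $R_v/M_v$. Let $f\in R_v[x]$ have $\phi$-expansion $f=\sum_{i=0}^n a_i\phi^i$, that is, $a_i\in K[x]$, $\deg a_i<\deg\phi$ for $0\le i\le n$, and $a_n\ne 0$. The $\phi$-Newton polygon of $f$ is defined as follows. For $0\le i\le n$ with $a_{n-i}\neq 0$ let $P_i=(i, v^x(a_{n-i}))$, and for two such indices $i<j$ let $$\mu_{ij}=\frac{v^x(a_{n-j})-v^x(a_{n-i})}{j-i},$$ an element of the divisible hull of $G$. Put $i_0=0$. As long as there is an index $j$ with $i_k<j\le n$ and $a_{n-j}\ne0$, let $i_{k+1}$ be the largest such index $j$ for which $\mu_{i_k j}$ is minimal. The vertices of the polygon are the $P_{i_k}$, and the slopes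 of its edges are the $\mu_{i_k i_{k+1}}$; they are strictly increasing in $k$. Assume that $v^x(a_0)\neq 0$, that $v^x(a_j)=0$ for some $j$ with $0\le j\le n$, and, $s$ being the least such $j$, that $a_i\ne 0$ for some $i<s$. Let $\lambda_1>\dots>\lambda_l$ be all the positive slopes of the $\phi$-Newton polygon of $f$, and for $1\le j\le l$ let $\mathfrak d_j$ be the least positive integer with $\mathfrak d_j\lambda_j\in G_v$. Then $f$ has an irreducible factor $g$ over $K$ with $$\deg g\ \ge\ \max_{1\le j\le l}\ \mathfrak d_j\, m .$$ -/

import Mathlib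

open Polynomial

namespace KrullNewton

noncomputable section

/-- The value group `G_v = v(Kˣ)` of an additively written Krull valuation `v : K → G ∪ {∞}`,
as a subgroup of the ordered group `G` in which the values are taken. -/
def valueGroup {K G : Type*} [Field K] [AddCommGroup G] [LinearOrder G] [IsOrderedAddMonoid G]
    (v : AddValuation K (WithTop G)) : AddSubgroup G where
  carrier := {g | ∃ x : K, v x = (g : WithTop G)}
  zero_mem' := ⟨1, by simp⟩
  add_mem' := by
    rintro a b ⟨x, hx⟩ ⟨y, hy⟩
    exact ⟨x * y, by simp [hx, hy]⟩
  neg_mem' := by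
    rintro a ⟨x, hx⟩
    have hx0 : x ≠ 0 := by
      rintro rfl
      simp at hx
    refine ⟨x⁻¹, ?_⟩
    have h : v x + v x⁻¹ = 0 := by
      rw [← AddValuation.map_mul, mul_inv_cancel₀ hx0, AddValuation.map_one]
    rw [hx] at h
    cases hy : v x⁻¹ with
    | top => rw [hy] at h; simp at h
    | coe b =>
      rw [hy] at h
      norm_cast at h ⊢
      exact (neg_eq_of_add_eq_zero_right h).symm

/-- The valuation ring `R_v = {x ∈ K | v x ≥ 0}`. -/
def valuationRing {K G : Type*} [Field K] [AddCommGroup G] [LinearOrder G] [IsOrderedAddMonoid G]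
    (v : AddValuation K (WithTop G)) : ValuationSubring K :=
  (AddValuation.toValuation v).valuationSubring

theorem mem_valuationRing_iff {K G : Type*} [Field K] [AddCommGroup G] [LinearOrder G]
    [IsOrderedAddMonoid G] (v : AddValuation K (WithTop G)) (x : K) :
    x ∈ valuationRing v ↔ 0 ≤ v x :=
  Iff.rfl

/-- The Gaussian prolongation on polynomials: `v^x(∑ cᵢ xⁱ) = minᵢ v(cᵢ)` (and `∞` at `0`). -/
def gaussVal {K G : Type*} [Field K] [AddCommGroup G] [LinearOrder G] [IsOrderedAddMonoid G]
    (v : AddValuation K (WithTop G)) (p : K[X]) : WithTop G :=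
  p.support.inf fun i => v (p.coeff i)

/-- `f = ∑_{i ≤ n} aᵢ φⁱ` with `deg aᵢ < deg φ` and `aₙ ≠ 0` is the `φ`-expansion of `f`.
Only the values of `a` at indices `≤ n` matter. -/
structure IsExpansion {K : Type*} [Field K] (φ f : K[X]) (n : ℕ) (a : ℕ → K[X]) : Prop where
  degree_lt : ∀ i ≤ n, (a i).degree < φ.degree
  leading_ne_zero : a n ≠ 0
  eq_sum : f = ∑ i ∈ Finset.range (n + 1), a i * φ ^ i

/-- The slope `μ_{ij} = (v^x(a_{n-j}) - v^x(a_{n-i})) / (j - i)` of the segment that joins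
`P_i = (i, v^x(a_{n-i}))` and `P_j = (j, v^x(a_{n-j}))`, an element of the divisible hull.
It is used only for `i < j ≤ n` with `a_{n-i}` and `a_{n-j}` nonzero, so that both values are
finite. -/
def polygonSlope {K G : Type*} [Field K] [AddCommGroup G] [LinearOrder G] [IsOrderedAddMonoid G]
    (v : AddValuation K (WithTop G)) (n : ℕ) (a : ℕ → K[X]) (i j : ℕ) : DivisibleHull G :=
  ((j : ℚ) - (i : ℚ))⁻¹ •
    DivisibleHull.coeAddMonoidHom G
      ((gaussVal v (a (n - j))).untopD 0 - (gaussVal v (a (n - i))).untopD 0)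

/-- `j` is the vertex index that follows the vertex index `i`: among the `j'` with
`i < j' ≤ n` and `a_{n-j'} ≠ 0`, it is the largest one at which `μ_{ij'}` is minimal. -/
def IsEdge {K G : Type*} [Field K] [AddCommGroup G] [LinearOrder G] [IsOrderedAddMonoid G]
    (v : AddValuation K (WithTop G)) (n : ℕ) (a : ℕ → K[X]) (i j : ℕ) : Prop :=
  i < j ∧ j ≤ n ∧ a (n - j) ≠ 0 ∧
    ∀ j', i < j' → j' ≤ n → a (n - j') ≠ 0 →
      polygonSlope v n a i j ≤ polygonSlope v n a i j' ∧
        (polygonSlope v n a i j' = polygonSlope v n a i j → j' ≤ j)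

/-- `P_i` is a vertex of the Newton polygon: it is reached from `P_0` by successive edges. -/
def IsVertex {K G : Type*} [Field K] [AddCommGroup G] [LinearOrder G] [IsOrderedAddMonoid G]
    (v : AddValuation K (WithTop G)) (n : ℕ) (a : ℕ → K[X]) (i : ℕ) : Prop :=
  Relation.ReflTransGen (IsEdge v n a) 0 i

/-- `μ` is the slope of an edge of the Newton polygon of the expansion `a_0, …, a_n`. -/
def IsPolygonSlope {K G : Type*} [Field K] [AddCommGroup G] [LinearOrder G]
    [IsOrderedAddMonoid G] (v : AddValuation K (WithTop G)) (n : ℕ) (a : ℕ → K[X])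
    (μ : DivisibleHull G) : Prop :=
  ∃ i j, IsVertex v n a i ∧ IsEdge v n a i j ∧ μ = polygonSlope v n a i j

end

end KrullNewton

/-! Fix a positive slope `μ` and give the term `aᵢφ^i` of a `φ`-expansion the value `v^x(aᵢ) + iμ`.
Call a term dominant if it alone has the least value. If `a`, `b` have degree below `m`,
irreducibility of the reduction of `φ` makes `ab mod φ` have value exactly `v^x(a) + v^x(b)`, while
the quotient has at least that value (`gaussVal_mul_modByMonic_and_divByMonic`). The quotient enters
with one more factor `φ`, hence with a surplus `μ > 0`, so having a dominant term is stable under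
products (`hasDominantTerm_mul`). An edge of slope `μ` gives `f` two terms of least value, so `f`
has no dominant term, and neither has some irreducible factor `g`. Two terms of `g`, at indices `i <
j`, then have equal finite values. Thus `(j - i)μ ∈ G_v`, so `𝔡 ≤ j - i ≤ j`, and `deg g ≥ jm ≥ 𝔡m`.
Taking the slope with the largest `𝔡` gives the theorem. -/

namespace KrullNewton

/-! ### The Gauss valuation and division by `φ`. -/

section Gauss

variable {K G : Type*} [Field K] [AddCommGroup G] [LinearOrder G] [IsOrderedAddMonoid G]
  (v : AddValuation K (WithTop G))

theorem le_gaussVal_iff (p : K[X]) (γ : WithTop G) :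
    γ ≤ gaussVal v p ↔ ∀ i, γ ≤ v (p.coeff i) := by
  rw [gaussVal, Finset.le_inf_iff]
  refine ⟨fun h i => ?_, fun h i _ => h i⟩
  by_cases hi : p.coeff i = 0
  · simp [hi]
  · exact h i (mem_support_iff.2 hi)

theorem gaussVal_le (p : K[X]) (i : ℕ) : gaussVal v p ≤ v (p.coeff i) :=
  (le_gaussVal_iff v p _).1 le_rfl i

theorem gaussVal_zero : gaussVal v 0 = ⊤ := by
  simp [gaussVal]

theorem exists_gaussVal_eq {p : K[X]} (hp : p ≠ 0) :
    ∃ i, p.coeff i ≠ 0 ∧ gaussVal v p = v (p.coeff i) := by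
  obtain ⟨i, hi, h⟩ := Finset.exists_mem_eq_inf p.support (support_nonempty.2 hp)
    fun i => v (p.coeff i)
  exact ⟨i, mem_support_iff.1 hi, h⟩

theorem gaussVal_ne_top {p : K[X]} (hp : p ≠ 0) : gaussVal v p ≠ ⊤ := by
  obtain ⟨i, hi, h⟩ := exists_gaussVal_eq v hp
  rw [h]
  exact (AddValuation.ne_top_iff v).2 hi

theorem min_le_gaussVal_add (p q : K[X]) :
    min (gaussVal v p) (gaussVal v q) ≤ gaussVal v (p + q) := by
  refine (le_gaussVal_iff v _ _).2 fun i => ?_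
  rw [coeff_add]
  exact (min_le_min (gaussVal_le v p i) (gaussVal_le v q i)).trans (AddValuation.map_add v _ _)

theorem gaussVal_neg (p : K[X]) : gaussVal v (-p) = gaussVal v p := by
  simp [gaussVal]

theorem gaussVal_C_mul (c : K) (p : K[X]) :
    gaussVal v (C c * p) = v c + gaussVal v p := by
  rcases eq_or_ne p 0 with rfl | hp
  · simp [gaussVal_zero]
  apply le_antisymm
  · obtain ⟨i, -, h⟩ := exists_gaussVal_eq v hp
    rw [h, ← AddValuation.map_mul, ← coeff_C_mul]
    exact gaussVal_le v _ i
  · refine (le_gaussVal_iff v _ _).2 fun i => ?_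
    rw [coeff_C_mul, AddValuation.map_mul]
    exact add_le_add le_rfl (gaussVal_le v p i)

theorem gaussVal_map_nonneg (p : (valuationRing v)[X]) :
    0 ≤ gaussVal v (p.map (algebraMap (valuationRing v) K)) := by
  refine (le_gaussVal_iff v _ _).2 fun i => ?_
  rw [coeff_map]
  exact (mem_valuationRing_iff v _).1 (p.coeff i).2

theorem valuationRing_isUnit_iff (x : valuationRing v) : IsUnit x ↔ v (x : K) = 0 := by
  have h := (valuationRing v).valuation_eq_one_iff x
  rw [h]
  have h' := (AddValuation.toValuation v).isEquiv_valuation_valuationSubring.eq_one_iff_eq_one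
    (x := (x : K))
  exact h'.symm

theorem gaussVal_map_eq_zero_iff (p : (valuationRing v)[X]) :
    gaussVal v (p.map (algebraMap (valuationRing v) K)) = 0 ↔
      p.map (IsLocalRing.residue (valuationRing v)) ≠ 0 := by
  have key : p.map (IsLocalRing.residue (valuationRing v)) ≠ 0 ↔
      ∃ i, v (p.coeff i : K) = 0 := by
    rw [← not_iff_not, not_not, Polynomial.ext_iff, not_exists]
    refine forall_congr' fun i => ?_
    rw [coeff_map, coeff_zero, IsLocalRing.residue_eq_zero_iff, IsLocalRing.mem_maximalIdeal,
      mem_nonunits_iff, valuationRing_isUnit_iff]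
  rw [key]
  constructor
  · intro h
    have hp : p.map (algebraMap (valuationRing v) K) ≠ 0 := by
      intro h0
      rw [h0, gaussVal_zero] at h
      exact WithTop.top_ne_zero h
    obtain ⟨i, -, hi⟩ := exists_gaussVal_eq v hp
    rw [h, coeff_map] at hi
    exact ⟨i, hi.symm⟩
  · rintro ⟨i, hi⟩
    refine le_antisymm ?_ (gaussVal_map_nonneg v p)
    have := gaussVal_le v (p.map (algebraMap (valuationRing v) K)) i
    rw [coeff_map] at this
    exact this.trans hi.le

/-- Every nonzero polynomial is a constant times a primitive integral one. -/
theorem exists_eq_C_mul_map {p : K[X]} (hp : p ≠ 0) :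
    ∃ (c : K) (q : (valuationRing v)[X]), c ≠ 0 ∧
      p = C c * q.map (algebraMap (valuationRing v) K) ∧ gaussVal v p = v c ∧
      q.map (IsLocalRing.residue (valuationRing v)) ≠ 0 := by
  obtain ⟨i, hi, h⟩ := exists_gaussVal_eq v hp
  set c := p.coeff i with hc
  have hpc : p = C c * (C c⁻¹ * p) := by
    rw [← mul_assoc, ← C_mul, mul_inv_cancel₀ hi, C_1, one_mul]
  have hvc : v c ≠ ⊤ := (AddValuation.ne_top_iff v).2 hi
  have h0 : gaussVal v (C c⁻¹ * p) = 0 := by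
    have h1 := gaussVal_C_mul v c (C c⁻¹ * p)
    rw [← hpc, h] at h1
    have h2 : v c + 0 = v c + gaussVal v (C c⁻¹ * p) := by rw [add_zero]; exact h1
    exact ((WithTop.add_left_inj hvc).1 h2).symm
  have hl : C c⁻¹ * p ∈ lifts (algebraMap (valuationRing v) K) := by
    rw [lifts_iff_coeff_lifts]
    intro k
    exact ⟨⟨_, (mem_valuationRing_iff v _).2 (h0.ge.trans (gaussVal_le v _ k))⟩, rfl⟩
  obtain ⟨q, hq⟩ := (mem_lifts _).1 hl
  refine ⟨c, q, hi, by rw [hq]; exact hpc, h, ?_⟩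
  rw [← gaussVal_map_eq_zero_iff, hq, h0]

section Mul

variable {v} {φ : (valuationRing v)[X]} (hφ : φ.Monic)
  (hirr : Irreducible (φ.map (IsLocalRing.residue (valuationRing v))))
include hφ hirr

/-- After scaling, `a` and `b` are integral with nonzero reductions of degree below `m`. The
reduction of `φ` is prime and divides neither, hence not their product, so the remainder stays
primitive. The quotient is merely integral. -/
theorem gaussVal_mul_modByMonic_and_divByMonic {a b : K[X]}
    (ha : a.degree < (φ.map (algebraMap (valuationRing v) K)).degree)
    (hb : b.degree < (φ.map (algebraMap (valuationRing v) K)).degree) :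
    gaussVal v ((a * b) %ₘ φ.map (algebraMap (valuationRing v) K)) =
        gaussVal v a + gaussVal v b ∧
      gaussVal v a + gaussVal v b ≤
        gaussVal v ((a * b) /ₘ φ.map (algebraMap (valuationRing v) K)) := by
  rcases eq_or_ne a 0 with rfl | ha0
  · simp [gaussVal_zero]
  rcases eq_or_ne b 0 with rfl | hb0
  · simp [gaussVal_zero]
  obtain ⟨c, p, hc, rfl, hvc, hp⟩ := exists_eq_C_mul_map v ha0
  obtain ⟨d, q, hd, rfl, hvd, hq⟩ := exists_eq_C_mul_map v hb0
  have hinj : Function.Injective (algebraMap (valuationRing v) K) := Subtype.val_injective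
  have hdeg : ∀ r : (valuationRing v)[X], ∀ e : K, e ≠ 0 →
      (C e * r.map (algebraMap (valuationRing v) K)).degree <
        (φ.map (algebraMap (valuationRing v) K)).degree →
      r.map (IsLocalRing.residue (valuationRing v)) ≠ 0 →
      ¬ φ.map (IsLocalRing.residue (valuationRing v)) ∣
        r.map (IsLocalRing.residue (valuationRing v)) := by
    intro r e he h h0 hdvd
    rw [degree_C_mul he, degree_map_eq_of_injective hinj, degree_map_eq_of_injective hinj] at h
    have h1 := degree_le_of_dvd hdvd h0
    rw [hφ.degree_map] at h1
    exact absurd (h1.trans degree_map_le) (not_le.2 h)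
  have hmod : ((p * q) %ₘ φ).map (IsLocalRing.residue (valuationRing v)) ≠ 0 := by
    rw [map_modByMonic _ hφ, Ne, modByMonic_eq_zero_iff_dvd (hφ.map _), Polynomial.map_mul]
    intro h
    rcases hirr.prime.dvd_or_dvd h with h | h
    · exact hdeg p c hc ha hp h
    · exact hdeg q d hd hb hq h
  have hcd : c * d ≠ 0 := mul_ne_zero hc hd
  have hprod : C c * p.map (algebraMap (valuationRing v) K) *
      (C d * q.map (algebraMap (valuationRing v) K)) =
      C (c * d) * (p * q).map (algebraMap (valuationRing v) K) := by
    rw [Polynomial.map_mul, C_mul]; ring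
  -- Division by the monic `φ` over `R_v`, rescaled by `cd`, is the division over `K`.
  have huniq := div_modByMonic_unique
    (f := C (c * d) * (p * q).map (algebraMap (valuationRing v) K))
    (C (c * d) * ((p * q) /ₘ φ).map (algebraMap (valuationRing v) K))
    (C (c * d) * ((p * q) %ₘ φ).map (algebraMap (valuationRing v) K))
    (hφ.map (algebraMap (valuationRing v) K))
    ⟨by
      conv_rhs => rw [← modByMonic_add_div (p * q) φ]
      rw [Polynomial.map_add, Polynomial.map_mul]; ring, by
      rw [degree_C_mul hcd, map_modByMonic _ hφ]
      exact degree_modByMonic_lt _ (hφ.map _)⟩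
  rw [hvc, hvd, hprod, huniq.1, huniq.2, gaussVal_C_mul v, gaussVal_C_mul v,
    (gaussVal_map_eq_zero_iff v _).2 hmod, AddValuation.map_mul]
  exact ⟨add_zero _, le_add_of_nonneg_right (gaussVal_map_nonneg v _)⟩

end Mul

end Gauss

end KrullNewton

namespace KrullNewton

/-! ### `φ`-expansions by iterated division. -/

section Expansion

variable {K : Type*} [Field K] {φ : K[X]}

theorem add_divByMonic (hφ : φ.Monic) (p q : K[X]) :
    (p + q) /ₘ φ = p /ₘ φ + q /ₘ φ := by
  refine (div_modByMonic_unique _ (p %ₘ φ + q %ₘ φ) hφ ⟨?_, ?_⟩).1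
  · conv_rhs => rw [← modByMonic_add_div p φ, ← modByMonic_add_div q φ]
    ring
  · exact (degree_add_le _ _).trans_lt
      (max_lt (degree_modByMonic_lt _ hφ) (degree_modByMonic_lt _ hφ))

/-- The `i`-th coefficient of the `φ`-expansion of `p`. -/
noncomputable def expCoeff (φ : K[X]) (i : ℕ) (p : K[X]) : K[X] :=
  ((· /ₘ φ)^[i] p) %ₘ φ

theorem expCoeff_zero_index (p : K[X]) : expCoeff φ 0 p = p %ₘ φ := rfl

theorem expCoeff_succ (i : ℕ) (p : K[X]) : expCoeff φ (i + 1) p = expCoeff φ i (p /ₘ φ) := rfl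

theorem degree_expCoeff_lt (hφ : φ.Monic) (i : ℕ) (p : K[X]) :
    (expCoeff φ i p).degree < φ.degree :=
  degree_modByMonic_lt _ hφ

theorem expCoeff_add (hφ : φ.Monic) (i : ℕ) (p q : K[X]) :
    expCoeff φ i (p + q) = expCoeff φ i p + expCoeff φ i q := by
  induction i generalizing p q with
  | zero => exact add_modByMonic _ _
  | succ i ih => rw [expCoeff_succ, add_divByMonic hφ, ih]; rfl

theorem expCoeff_zero (i : ℕ) : expCoeff φ i 0 = 0 := by
  induction i with
  | zero => exact zero_modByMonic _
  | succ i ih => rw [expCoeff_succ, zero_divByMonic, ih]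

theorem expCoeff_mul_pow (hφ : φ.Monic) {b : K[X]} (hb : b.degree < φ.degree) (i j : ℕ) :
    expCoeff φ i (b * φ ^ j) = if i = j then b else 0 := by
  induction i generalizing j with
  | zero =>
    cases j with
    | zero => rw [expCoeff_zero_index, pow_zero, mul_one, if_pos rfl, (modByMonic_eq_self_iff hφ).2 hb]
    | succ j =>
      rw [expCoeff_zero_index, if_neg (by omega), modByMonic_eq_zero_iff_dvd hφ, pow_succ, ← mul_assoc]
      exact dvd_mul_left _ _
  | succ i ih =>
    cases j with
    | zero =>
      rw [expCoeff_succ, pow_zero, mul_one, (divByMonic_eq_zero_iff hφ).2 hb, expCoeff_zero,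
        if_neg (by omega)]
    | succ j =>
      rw [expCoeff_succ, show b * φ ^ (j + 1) = φ * (b * φ ^ j) by ring,
        mul_divByMonic_cancel_left _ hφ, ih]
      simp

theorem expCoeff_sum (hφ : φ.Monic) {ι : Type*} (s : Finset ι) (p : ι → K[X]) (i : ℕ) :
    expCoeff φ i (∑ k ∈ s, p k) = ∑ k ∈ s, expCoeff φ i (p k) := by
  classical
  induction s using Finset.induction_on with
  | empty => simp [expCoeff_zero]
  | insert k s hk ih => rw [Finset.sum_insert hk, Finset.sum_insert hk, expCoeff_add hφ, ih]

theorem mul_natDegree_le_of_expCoeff_ne_zero (hφ : φ.Monic) {i : ℕ} {p : K[X]}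
    (h : expCoeff φ i p ≠ 0) : i * φ.natDegree ≤ p.natDegree := by
  induction i generalizing p with
  | zero => simp
  | succ i ih =>
    rw [expCoeff_succ] at h
    have h1 := ih h
    have h2 : p /ₘ φ ≠ 0 := by
      intro h0
      rw [h0, expCoeff_zero] at h
      exact h rfl
    rw [Ne, divByMonic_eq_zero_iff hφ, not_lt] at h2
    have h3 := natDegree_le_natDegree h2
    rw [natDegree_divByMonic _ hφ] at h1
    rw [add_mul, one_mul]
    omega

theorem sum_expCoeff (hφ : φ.Monic) (hdeg : 0 < φ.natDegree) {N : ℕ} (p : K[X])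
    (hN : p.natDegree < N) : ∑ i ∈ Finset.range N, expCoeff φ i p * φ ^ i = p := by
  induction N generalizing p with
  | zero => omega
  | succ N ih =>
    rw [Finset.sum_range_succ']
    have hq : ∑ i ∈ Finset.range N, expCoeff φ i (p /ₘ φ) * φ ^ i = p /ₘ φ := by
      by_cases h : p /ₘ φ = 0
      · rw [h]; simp [expCoeff_zero]
      · apply ih
        rw [divByMonic_eq_zero_iff hφ, not_lt] at h
        have h3 := natDegree_le_natDegree h
        rw [natDegree_divByMonic _ hφ]
        omega
    have : ∑ i ∈ Finset.range N, expCoeff φ (i + 1) p * φ ^ (i + 1) = φ * (p /ₘ φ) := by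
      conv_rhs => rw [← hq, Finset.mul_sum]
      refine Finset.sum_congr rfl fun i _ => ?_
      rw [expCoeff_succ]; ring
    rw [this, expCoeff_zero_index, pow_zero, mul_one, add_comm]
    exact modByMonic_add_div p φ

/-- Ensures that a product of two terms expands into at most two terms, at consecutive powers of
`φ`. -/
theorem degree_mul_divByMonic_lt (hφ : φ.Monic) {a b : K[X]} (ha : a.degree < φ.degree)
    (hb : b.degree < φ.degree) : ((a * b) /ₘ φ).degree < φ.degree := by
  have hφ0 := hφ.ne_zero
  by_cases h0 : (a * b) /ₘ φ = 0
  · rw [h0, degree_zero]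
    exact bot_lt_iff_ne_bot.2 (degree_eq_bot.not.2 hφ0)
  have hab : a * b ≠ 0 := by
    rintro hab
    rw [hab, zero_divByMonic] at h0
    exact h0 rfl
  have ha0 := left_ne_zero_of_mul hab
  have hb0 := right_ne_zero_of_mul hab
  refine degree_lt_degree ?_
  rw [natDegree_divByMonic _ hφ, natDegree_mul ha0 hb0]
  have h1 := natDegree_lt_natDegree ha0 ha
  have h2 := natDegree_lt_natDegree hb0 hb
  omega

end Expansion

/-! ### Term values for a positive weight, and dominant terms. -/

section Augmented

variable {K H : Type*} [Field K] [AddCommGroup H] [LinearOrder H] [IsOrderedAddMonoid H]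

/-- `u` is a function on `K[X]` that behaves like a valuation with respect to which `φ` is a
key polynomial. -/
structure IsKeyFor (φ : K[X]) (u : K[X] → WithTop H) : Prop where
  monic : φ.Monic
  natDegree_pos : 0 < φ.natDegree
  zero : u 0 = ⊤
  ne_top : ∀ {p}, p ≠ 0 → u p ≠ ⊤
  min_le_add : ∀ p q, min (u p) (u q) ≤ u (p + q)
  neg : ∀ p, u (-p) = u p
  mul_mod : ∀ {a b : K[X]}, a.degree < φ.degree → b.degree < φ.degree →
    u ((a * b) %ₘ φ) = u a + u b
  mul_div : ∀ {a b : K[X]}, a.degree < φ.degree → b.degree < φ.degree →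
    u a + u b ≤ u ((a * b) /ₘ φ)

/-- The value `u(aᵢ) + i μ` of the `i`-th term of the `φ`-expansion of `p`. -/
noncomputable def termVal (φ : K[X]) (u : K[X] → WithTop H) (μ : H) (p : K[X]) (i : ℕ) :
    WithTop H :=
  u (expCoeff φ i p) + ((i • μ : H) : WithTop H)

/-- `p` has exactly one term of least value in its `φ`-expansion. -/
def HasDominantTerm (φ : K[X]) (u : K[X] → WithTop H) (μ : H) (p : K[X]) : Prop :=
  ∃ (γ : H) (i : ℕ) (A r : K[X]), p = A * φ ^ i + r ∧ A.degree < φ.degree ∧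
    u A + ((i • μ : H) : WithTop H) = γ ∧ ∀ k, (γ : WithTop H) < termVal φ u μ r k

namespace IsKeyFor

variable {φ : K[X]} {u : K[X] → WithTop H} (h : IsKeyFor φ u) {μ : H}
include h

theorem termVal_zero (k : ℕ) : termVal φ u μ 0 k = ⊤ := by
  rw [termVal, expCoeff_zero, h.zero, top_add]

theorem lt_termVal_add {γ : WithTop H} {p q : K[X]} {k : ℕ} (hp : γ < termVal φ u μ p k)
    (hq : γ < termVal φ u μ q k) : γ < termVal φ u μ (p + q) k := by
  have h1 := h.min_le_add (expCoeff φ k p) (expCoeff φ k q)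
  rw [termVal, expCoeff_add h.monic]
  refine (lt_min hp hq).trans_le ?_
  rw [termVal, termVal, min_add_add_right]
  gcongr

theorem lt_termVal_sum {γ : H} {ι : Type*} (s : Finset ι) (p : ι → K[X]) (k : ℕ)
    (hp : ∀ i ∈ s, (γ : WithTop H) < termVal φ u μ (p i) k) :
    (γ : WithTop H) < termVal φ u μ (∑ i ∈ s, p i) k := by
  refine Finset.sum_induction p (fun q => (γ : WithTop H) < termVal φ u μ q k)
    (fun _ _ => h.lt_termVal_add) ?_ hp
  rw [h.termVal_zero]
  exact WithTop.coe_lt_top γ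

theorem lt_termVal_mul_pow {γ : H} {b : K[X]} {j : ℕ} (hb : b.degree < φ.degree)
    (hγ : (γ : WithTop H) < u b + ((j • μ : H) : WithTop H)) (k : ℕ) :
    (γ : WithTop H) < termVal φ u μ (b * φ ^ j) k := by
  rw [termVal, expCoeff_mul_pow h.monic hb]
  split_ifs with hk
  · rwa [hk]
  · rw [h.zero, top_add]
    exact WithTop.coe_lt_top γ

/-- The product of two terms is the term formed with the remainder of the product of the
coefficients, up to terms of larger value. -/
theorem exists_term_mul_term (hμ : 0 < μ) {γ δ : H} {a b : K[X]} {i j : ℕ}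
    (ha : a.degree < φ.degree) (hb : b.degree < φ.degree)
    (hγ : (γ : WithTop H) ≤ u a + ((i • μ : H) : WithTop H))
    (hδ : (δ : WithTop H) ≤ u b + ((j • μ : H) : WithTop H)) :
    ∃ r : K[X], a * φ ^ i * (b * φ ^ j) = ((a * b) %ₘ φ) * φ ^ (i + j) + r ∧
      ∀ k, ((γ + δ : H) : WithTop H) < termVal φ u μ r k := by
  refine ⟨((a * b) /ₘ φ) * φ ^ (i + j + 1), ?_, ?_⟩
  · rw [show a * φ ^ i * (b * φ ^ j) = a * b * φ ^ (i + j) by ring]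
    conv_lhs => rw [← modByMonic_add_div (a * b) φ]
    ring
  · refine h.lt_termVal_mul_pow (degree_mul_divByMonic_lt h.monic ha hb) ?_
    have h1 := h.mul_div ha hb
    have h2 : ((γ + δ : H) : WithTop H) ≤ u a + u b + (((i + j) • μ : H) : WithTop H) := by
      rw [add_smul, WithTop.coe_add, WithTop.coe_add]
      exact (add_le_add hγ hδ).trans_eq (add_add_add_comm _ _ _ _)
    have h3 : ((γ + δ : H) : WithTop H) ≤
        u ((a * b) /ₘ φ) + (((i + j) • μ : H) : WithTop H) := h2.trans (by gcongr)
    -- Adding `μ` gives a strict increase only for finite values; a zero quotient has value `⊤`.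
    cases hx : u ((a * b) /ₘ φ) with
    | top => rw [top_add]; exact WithTop.coe_lt_top _
    | coe x =>
      rw [hx] at h3
      norm_cast at h3 ⊢
      refine h3.trans_lt ?_
      rw [succ_nsmul]
      gcongr
      exact lt_add_of_pos_right _ hμ

theorem lt_termVal_term_mul_term (hμ : 0 < μ) {γ δ : H} {a b : K[X]} {i j : ℕ}
    (ha : a.degree < φ.degree) (hb : b.degree < φ.degree)
    (hγ : (γ : WithTop H) ≤ u a + ((i • μ : H) : WithTop H))
    (hδ : (δ : WithTop H) < u b + ((j • μ : H) : WithTop H)) (k : ℕ) :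
    ((γ + δ : H) : WithTop H) < termVal φ u μ (a * φ ^ i * (b * φ ^ j)) k := by
  obtain ⟨r, hr, hlt⟩ := h.exists_term_mul_term hμ ha hb hγ hδ.le
  rw [hr]
  refine h.lt_termVal_add (h.lt_termVal_mul_pow (degree_modByMonic_lt _ h.monic) ?_ k) (hlt k)
  rw [h.mul_mod ha hb, add_smul, WithTop.coe_add, WithTop.coe_add, add_add_add_comm]
  exact WithTop.add_lt_add_of_le_of_lt WithTop.coe_ne_top hγ hδ

theorem lt_termVal_mul (hμ : 0 < μ) {γ δ : H} {p q : K[X]}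
    (hp : ∀ i, (γ : WithTop H) ≤ termVal φ u μ p i)
    (hq : ∀ i, (δ : WithTop H) < termVal φ u μ q i) (k : ℕ) :
    ((γ + δ : H) : WithTop H) < termVal φ u μ (p * q) k := by
  rw [← sum_expCoeff h.monic h.natDegree_pos p (Nat.lt_succ_self _),
    ← sum_expCoeff h.monic h.natDegree_pos q (Nat.lt_succ_self _), Finset.sum_mul_sum]
  refine h.lt_termVal_sum _ _ k fun i _ => h.lt_termVal_sum _ _ k fun j _ => ?_
  exact h.lt_termVal_term_mul_term hμ (degree_expCoeff_lt h.monic _ _)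
    (degree_expCoeff_lt h.monic _ _) (hp i) (hq j) k

theorem le_termVal_mul_pow {γ : H} {A : K[X]} {i : ℕ} (hA : A.degree < φ.degree)
    (hγ : (γ : WithTop H) ≤ u A + ((i • μ : H) : WithTop H)) (k : ℕ) :
    (γ : WithTop H) ≤ termVal φ u μ (A * φ ^ i) k := by
  rw [termVal, expCoeff_mul_pow h.monic hA]
  split_ifs with hk
  · rwa [hk]
  · rw [h.zero, top_add]
    exact le_top

/-- The remainder `r` may also contribute at index `i`, with larger value. Hence `A` need not be the
exact coefficient, and all cross terms can go into the new remainder. -/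
theorem hasDominantTerm_mul (hμ : 0 < μ) {p q : K[X]} (hp : HasDominantTerm φ u μ p)
    (hq : HasDominantTerm φ u μ q) : HasDominantTerm φ u μ (p * q) := by
  obtain ⟨γ, i, A, r, rfl, hA, hγ, hr⟩ := hp
  obtain ⟨δ, j, B, t, rfl, hB, hδ, ht⟩ := hq
  obtain ⟨w, hw, hlt⟩ := h.exists_term_mul_term hμ hA hB hγ.ge hδ.ge
  refine ⟨γ + δ, i + j, (A * B) %ₘ φ, w + A * φ ^ i * t + r * (B * φ ^ j) + r * t, ?_,
    degree_modByMonic_lt _ h.monic, ?_, fun k => ?_⟩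
  · linear_combination hw
  · rw [h.mul_mod hA hB, add_smul, WithTop.coe_add, WithTop.coe_add, add_add_add_comm, hγ, hδ]
  · refine h.lt_termVal_add (h.lt_termVal_add (h.lt_termVal_add (hlt k) ?_) ?_) ?_
    · exact h.lt_termVal_mul hμ (h.le_termVal_mul_pow hA hγ.ge) ht k
    · rw [mul_comm, add_comm γ δ]
      exact h.lt_termVal_mul hμ (h.le_termVal_mul_pow hB hδ.ge) hr k
    · exact h.lt_termVal_mul hμ (fun i => (hr i).le) ht k

theorem hasDominantTerm_of_isUnit {p : K[X]} (hp : IsUnit p) : HasDominantTerm φ u μ p := by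
  obtain ⟨γ, hγ⟩ := WithTop.ne_top_iff_exists.1 (h.ne_top hp.ne_zero)
  refine ⟨γ, 0, p, 0, by simp, ?_, by simp [hγ], fun k => ?_⟩
  · rw [degree_eq_zero_of_isUnit hp]
    exact natDegree_pos_iff_degree_pos.1 h.natDegree_pos
  · rw [h.termVal_zero]
    exact WithTop.coe_lt_top _

theorem hasDominantTerm_of_irreducible_factors (hμ : 0 < μ) {p : K[X]} (hp : p ≠ 0)
    (hfac : ∀ g, Irreducible g → g ∣ p → HasDominantTerm φ u μ g) : HasDominantTerm φ u μ p := by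
  induction p using WfDvdMonoid.induction_on_irreducible with
  | zero => exact absurd rfl hp
  | unit p hu => exact h.hasDominantTerm_of_isUnit hu
  | mul p g hp0 hg ih =>
    exact h.hasDominantTerm_mul hμ (hfac g hg (dvd_mul_right _ _))
      (ih hp0 fun q hq hqp => hfac q hq (hqp.mul_left _))

theorem not_hasDominantTerm {p : K[X]} {i j : ℕ} (hij : i ≠ j)
    (hi : ∀ k, termVal φ u μ p i ≤ termVal φ u μ p k)
    (hj : ∀ k, termVal φ u μ p j ≤ termVal φ u μ p k) : ¬ HasDominantTerm φ u μ p := by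
  rintro ⟨γ, k, A, r, rfl, hA, hγ, hr⟩
  -- The coefficient at `k` is `A + c`, with `c` that of `r`. Were its value too large, so would be
  -- that of `A = (A + c) - c`.
  have hk : termVal φ u μ (A * φ ^ k + r) k ≤ γ := by
    by_contra! hlt
    have hsum : expCoeff φ k (A * φ ^ k + r) = A + expCoeff φ k r := by
      rw [expCoeff_add h.monic, expCoeff_mul_pow h.monic hA, if_pos rfl]
    have hr' := hr k
    have hmin := h.min_le_add (A + expCoeff φ k r) (-expCoeff φ k r)
    rw [add_neg_cancel_right, h.neg] at hmin
    rw [termVal] at hlt hr'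
    rw [hsum] at hlt
    have hle := add_le_add_left hmin ((k • μ : H) : WithTop H)
    rw [← min_add_add_right, hγ] at hle
    exact absurd (lt_min hlt hr') (not_lt.2 hle)
  have hother : ∀ l, l ≠ k → (γ : WithTop H) < termVal φ u μ (A * φ ^ k + r) l := by
    intro l hl
    have := hr l
    rwa [termVal, expCoeff_add h.monic, expCoeff_mul_pow h.monic hA, if_neg hl, zero_add]
  have hik : i = k := by
    by_contra hne
    exact absurd ((hi k).trans hk) (not_le.2 (hother i hne))
  have hjk : j = k := by
    by_contra hne
    exact absurd ((hj k).trans hk) (not_le.2 (hother j hne))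
  exact hij (hik.trans hjk.symm)

theorem exists_two_minimal_terms {p : K[X]} (hp : p ≠ 0) (hnd : ¬ HasDominantTerm φ u μ p) :
    ∃ i j, i < j ∧ termVal φ u μ p i = termVal φ u μ p j ∧ expCoeff φ i p ≠ 0 ∧
      expCoeff φ j p ≠ 0 := by
  -- Coefficients of index above `natDegree p` vanish, so a minimum over this range is global.
  obtain ⟨i, -, hi⟩ := Finset.exists_min_image (Finset.range (p.natDegree + 1))
    (termVal φ u μ p) ⟨0, by simp⟩
  have hmin : ∀ k, termVal φ u μ p i ≤ termVal φ u μ p k := by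
    intro k
    by_cases hk : expCoeff φ k p = 0
    · rw [termVal, termVal, hk, h.zero, top_add]
      exact le_top
    · refine hi k (Finset.mem_range.2 (Nat.lt_succ_of_le ?_))
      exact (Nat.le_mul_of_pos_right k h.natDegree_pos).trans
        (mul_natDegree_le_of_expCoeff_ne_zero h.monic hk)
  have hi0 : expCoeff φ i p ≠ 0 := by
    intro h0
    apply hp
    rw [← sum_expCoeff h.monic h.natDegree_pos p (Nat.lt_succ_self _)]
    refine Finset.sum_eq_zero fun k _ => ?_
    by_cases hk : expCoeff φ k p = 0
    · rw [hk, zero_mul]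
    · have := hmin k
      rw [termVal, termVal, h0, h.zero, top_add, top_le_iff, WithTop.add_eq_top] at this
      rcases this with h' | h'
      · exact absurd h' (h.ne_top hk)
      · exact absurd h' WithTop.coe_ne_top
  obtain ⟨γ, hγ⟩ : ∃ γ : H, termVal φ u μ p i = γ := by
    obtain ⟨x, hx⟩ := WithTop.ne_top_iff_exists.1 (h.ne_top hi0)
    exact ⟨x + i • μ, by rw [termVal, ← hx, WithTop.coe_add]⟩
  -- Otherwise the term at `i` would be dominant.
  obtain ⟨k, hki, hk⟩ : ∃ k, k ≠ i ∧ termVal φ u μ p k ≤ termVal φ u μ p i := by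
    by_contra! hcon
    refine hnd ⟨γ, i, expCoeff φ i p, p - expCoeff φ i p * φ ^ i, by ring,
      degree_expCoeff_lt h.monic _ _, hγ, fun k => ?_⟩
    have hsub := expCoeff_add h.monic k (expCoeff φ i p * φ ^ i) (p - expCoeff φ i p * φ ^ i)
    rw [add_sub_cancel, expCoeff_mul_pow h.monic (degree_expCoeff_lt h.monic _ _)] at hsub
    by_cases hki : k = i
    · subst hki
      rw [if_pos rfl, left_eq_add] at hsub
      rw [termVal, hsub, h.zero, top_add]
      exact WithTop.coe_lt_top _
    · rw [if_neg hki, zero_add] at hsub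
      have := hcon k hki
      rwa [hγ, termVal, hsub] at this
  have hk0 : expCoeff φ k p ≠ 0 := by
    intro h0
    rw [hγ, termVal, h0, h.zero, top_add, top_le_iff] at hk
    exact WithTop.coe_ne_top hk
  have heq := le_antisymm hk (hmin k)
  rcases lt_or_gt_of_ne hki with hlt | hlt
  · exact ⟨k, i, hlt, heq, hk0, hi0⟩
  · exact ⟨i, k, hlt, heq.symm, hi0, hk0⟩

end IsKeyFor

end Augmented

end KrullNewton

namespace KrullNewton

/-! ### Values in the divisible hull, where the slopes live. -/

section Hull

variable {K G : Type*} [Field K] [AddCommGroup G] [LinearOrder G] [IsOrderedAddMonoid G]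
  (v : AddValuation K (WithTop G))

/-- The Gaussian prolongation, with values in the divisible hull. -/
noncomputable def hullVal (p : K[X]) : WithTop (DivisibleHull G) :=
  (gaussVal v p).map (DivisibleHull.coeAddMonoidHom G)

theorem coeAddMonoidHom_monotone : Monotone (DivisibleHull.coeAddMonoidHom G) :=
  (DivisibleHull.coeOrderAddMonoidHom (M := G)).monotone'

theorem hullVal_of_ne_zero {p : K[X]} (hp : p ≠ 0) :
    hullVal v p = ((DivisibleHull.coeAddMonoidHom G ((gaussVal v p).untopD 0) :
      DivisibleHull G) : WithTop (DivisibleHull G)) := by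
  obtain ⟨x, hx⟩ := WithTop.ne_top_iff_exists.1 (gaussVal_ne_top v hp)
  rw [hullVal, ← hx]
  rfl

theorem gaussVal_untopD_mem {p : K[X]} (hp : p ≠ 0) :
    (gaussVal v p).untopD 0 ∈ valueGroup v := by
  obtain ⟨i, hi, h⟩ := exists_gaussVal_eq v hp
  obtain ⟨x, hx⟩ := WithTop.ne_top_iff_exists.1 (gaussVal_ne_top v hp)
  refine ⟨p.coeff i, ?_⟩
  rw [← h, ← hx]
  rfl

theorem isKeyFor_hullVal {φ : (valuationRing v)[X]} (hφ : φ.Monic)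
    (hirr : Irreducible (φ.map (IsLocalRing.residue (valuationRing v)))) :
    IsKeyFor (φ.map (algebraMap (valuationRing v) K)) (hullVal v) where
  monic := hφ.map _
  natDegree_pos := by
    rw [hφ.natDegree_map, ← hφ.natDegree_map (IsLocalRing.residue (valuationRing v))]
    exact hirr.natDegree_pos
  zero := by rw [hullVal, gaussVal_zero]; rfl
  ne_top hp := by rw [hullVal_of_ne_zero v hp]; exact WithTop.coe_ne_top
  min_le_add p q := by
    have hm := coeAddMonoidHom_monotone (G := G).withTop_map
    rw [hullVal, hullVal, ← hm.map_min]
    exact hm (min_le_gaussVal_add v p q)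
  neg p := by rw [hullVal, hullVal, gaussVal_neg]
  mul_mod ha hb := by
    rw [hullVal, (gaussVal_mul_modByMonic_and_divByMonic hφ hirr ha hb).1, WithTop.map_add]
    rfl
  mul_div ha hb := by
    rw [hullVal, hullVal, ← WithTop.map_add]
    exact coeAddMonoidHom_monotone.withTop_map
      (gaussVal_mul_modByMonic_and_divByMonic hφ hirr ha hb).2

end Hull

/-! ### Edges of the Newton polygon as ties between term values. -/

section Polygon

variable {K G : Type*} [Field K] [AddCommGroup G] [LinearOrder G] [IsOrderedAddMonoid G]
  {v : AddValuation K (WithTop G)} {n : ℕ} {a : ℕ → K[X]}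

/-- The ordinate of the point `P_i`, in the divisible hull. -/
noncomputable def ordinate (v : AddValuation K (WithTop G)) (n : ℕ) (a : ℕ → K[X]) (i : ℕ) :
    DivisibleHull G :=
  DivisibleHull.coeAddMonoidHom G ((gaussVal v (a (n - i))).untopD 0)

theorem le_polygonSlope_iff {i j : ℕ} (hij : i < j) (μ : DivisibleHull G) :
    μ ≤ polygonSlope v n a i j ↔ ordinate v n a i + ((j : ℚ) - i) • μ ≤ ordinate v n a j := by
  have hpos : (0 : ℚ) < (j : ℚ) - i := sub_pos.2 (Nat.cast_lt.2 hij)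
  rw [polygonSlope, le_inv_smul_iff_of_pos hpos, map_sub, le_sub_iff_add_le']
  rfl

theorem ordinate_add_polygonSlope {i j : ℕ} (hij : i < j) :
    ordinate v n a i + ((j : ℚ) - i) • polygonSlope v n a i j = ordinate v n a j := by
  have hpos : (0 : ℚ) < (j : ℚ) - i := sub_pos.2 (Nat.cast_lt.2 hij)
  rw [polygonSlope, smul_inv_smul₀ hpos.ne', map_sub]
  exact add_sub_cancel _ _

/-- The line through an edge of the Newton polygon lies below all the points `P_k`. -/
theorem IsVertex.line_le {i : ℕ} (hi : IsVertex v n a i) :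
    ∀ j, IsEdge v n a i j → ∀ k ≤ n, a (n - k) ≠ 0 →
      ordinate v n a i + ((k : ℚ) - i) • polygonSlope v n a i j ≤ ordinate v n a k := by
  have right : ∀ {i j : ℕ}, IsEdge v n a i j → ∀ k ≤ n, i ≤ k → a (n - k) ≠ 0 →
      ordinate v n a i + ((k : ℚ) - i) • polygonSlope v n a i j ≤ ordinate v n a k := by
    intro i j hij k hkn hik hk
    rcases hik.eq_or_lt with rfl | hik
    · rw [sub_self, zero_smul, add_zero]
    · exact (le_polygonSlope_iff hik _).1 (hij.2.2.2 k hik hkn hk).1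
  induction hi with
  | refl => exact fun j hj k hkn hk => right hj k hkn (Nat.zero_le k) hk
  | @tail h i _ hhi ih =>
    intro j hj k hkn hk
    rcases le_or_gt i k with hik | hki
    · exact right hj k hkn hik hk
    have h1 := ih i hhi k hkn hk
    have h2 := ordinate_add_polygonSlope (v := v) (n := n) (a := a) hhi.1
    have h3 := (le_polygonSlope_iff (hhi.1.trans hj.1) _).1
      (hhi.2.2.2 j (hhi.1.trans hj.1) hj.2.1 hj.2.2.1).1
    have h4 := ordinate_add_polygonSlope (v := v) (n := n) (a := a) hj.1
    have hpos : (0 : ℚ) < (j : ℚ) - i := sub_pos.2 (Nat.cast_lt.2 hj.1)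
    have hneg : ((k : ℚ) - i) ≤ 0 := sub_nonpos.2 (Nat.cast_le.2 hki.le)
    set μ' := polygonSlope v n a h i
    set μ := polygonSlope v n a i j
    -- Convexity at `P_i`: `j` was also a candidate when the edge from `h` to `i` was chosen, so
    -- `P_j` lies on or above the line of that edge.
    have hle : μ' ≤ μ := by
      rw [← smul_le_smul_iff_of_pos_left hpos]
      rw [← h4, ← h2, add_assoc, add_le_add_iff_left] at h3
      have : ((j : ℚ) - h) • μ' = ((i : ℚ) - h) • μ' + ((j : ℚ) - i) • μ' := by module
      rwa [this, add_le_add_iff_left] at h3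
    -- To the left of `P_i` the steeper line is the lower one, and the line of slope `μ'` through
    -- `P_i` is that of the preceding edge.
    calc ordinate v n a i + ((k : ℚ) - i) • μ
        ≤ ordinate v n a i + ((k : ℚ) - i) • μ' :=
          add_le_add le_rfl (smul_le_smul_of_nonpos_left hle hneg)
      _ = ordinate v n a h + ((k : ℚ) - h) • μ' := by rw [← h2]; module
      _ ≤ _ := h1

theorem IsVertex.le (hi : IsVertex v n a i) : i ≤ n := by
  induction hi with
  | refl => exact Nat.zero_le n
  | tail _ h _ => exact h.2.1

theorem IsVertex.coeff_ne_zero (hn : a n ≠ 0) (hi : IsVertex v n a i) : a (n - i) ≠ 0 := by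
  induction hi with
  | refl => exact hn
  | tail _ h _ => exact h.2.2.1

theorem IsExpansion.expCoeff_eq {φ f : K[X]} (hφ : φ.Monic) (ha : IsExpansion φ f n a) (i : ℕ) :
    expCoeff φ i f = if i ≤ n then a i else 0 := by
  rw [ha.eq_sum, expCoeff_sum hφ, Finset.sum_congr rfl fun k hk => expCoeff_mul_pow hφ
    (ha.degree_lt k (Nat.le_of_lt_succ (Finset.mem_range.1 hk))) i k, Finset.sum_ite_eq]
  simp

/-- Since `P_k` carries `a_{n-k}`, the term value is, up to a constant, the height of `P_k` above a
line of slope `μ`. -/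
theorem IsExpansion.termVal_eq {φ f : K[X]} (hφ : φ.Monic) (ha : IsExpansion φ f n a)
    (μ : DivisibleHull G) {k : ℕ} (hk : k ≤ n) (hk0 : a (n - k) ≠ 0) :
    termVal φ (hullVal v) μ f (n - k) =
      ((ordinate v n a k + ((n : ℚ) - k) • μ : DivisibleHull G) : WithTop (DivisibleHull G)) := by
  rw [termVal, ha.expCoeff_eq hφ, if_pos (Nat.sub_le n k), hullVal_of_ne_zero v hk0,
    WithTop.coe_add, ← Nat.cast_sub hk, Nat.cast_smul_eq_nsmul]
  rfl

/-- Both ends of an edge lie on its line and no `P_k` lies below it, so they tie for the least term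
value. -/
theorem IsExpansion.not_hasDominantTerm {φ f : K[X]} (hφ : IsKeyFor φ (hullVal v))
    (ha : IsExpansion φ f n a) {μ : DivisibleHull G} (hμ : IsPolygonSlope v n a μ) :
    ¬ HasDominantTerm φ (hullVal v) μ f := by
  obtain ⟨i, j, hi, hij, rfl⟩ := hμ
  set μ := polygonSlope v n a i j
  have hi0 := hi.coeff_ne_zero ha.leading_ne_zero
  have hline : ordinate v n a i + ((j : ℚ) - i) • μ = ordinate v n a j :=
    ordinate_add_polygonSlope hij.1
  have hmin : ∀ k, termVal φ (hullVal v) μ f (n - i) ≤ termVal φ (hullVal v) μ f k := by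
    intro k
    by_cases hk : expCoeff φ k f = 0
    · rw [termVal, termVal, hk, hφ.zero, top_add]
      exact le_top
    rw [ha.expCoeff_eq hφ.monic, ← Ne, ite_ne_right_iff] at hk
    obtain ⟨hkn, hk0⟩ := hk
    obtain ⟨t, htn, rfl⟩ : ∃ t ≤ n, k = n - t := ⟨n - k, Nat.sub_le n k, by omega⟩
    rw [ha.termVal_eq hφ.monic μ hi.le hi0, ha.termVal_eq hφ.monic μ htn hk0, WithTop.coe_le_coe]
    calc ordinate v n a i + ((n : ℚ) - i) • μ
        = ordinate v n a i + ((t : ℚ) - i) • μ + ((n : ℚ) - t) • μ := by module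
      _ ≤ _ := add_le_add (hi.line_le j hij t htn hk0) le_rfl
  have heq : termVal φ (hullVal v) μ f (n - j) = termVal φ (hullVal v) μ f (n - i) := by
    rw [ha.termVal_eq hφ.monic μ hi.le hi0, ha.termVal_eq hφ.monic μ hij.2.1 hij.2.2.1, ← hline]
    congr 1
    module
  refine hφ.not_hasDominantTerm (i := n - i) (j := n - j) ?_ hmin (heq ▸ hmin)
  have := hij.1
  have := hij.2.1
  omega

/-- A polynomial without dominant term for the weight `μ` has two terms of equal value, which
bounds its degree below by the order of `μ` modulo the value group. -/
theorem mul_natDegree_le_of_not_hasDominantTerm {φ g : K[X]} (hφ : IsKeyFor φ (hullVal v))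
    {μ : DivisibleHull G} (hg : g ≠ 0) (hnd : ¬ HasDominantTerm φ (hullVal v) μ g) {d : ℕ}
    (hd : d ∈ lowerBounds {e : ℕ | 0 < e ∧
      e • μ ∈ (valueGroup v).map (DivisibleHull.coeAddMonoidHom G)}) :
    d * φ.natDegree ≤ g.natDegree := by
  obtain ⟨i, j, hij, heq, hi, hj⟩ := hφ.exists_two_minimal_terms hg hnd
  have hle : d ≤ j - i := by
    refine hd ⟨by omega, ?_⟩
    rw [termVal, termVal, hullVal_of_ne_zero v hi, hullVal_of_ne_zero v hj, ← WithTop.coe_add,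
      ← WithTop.coe_add, WithTop.coe_inj] at heq
    -- Equality of the two term values says that `(j - i)μ` is the difference of the values of the
    -- coefficients at `i` and `j`.
    refine ⟨_, sub_mem (gaussVal_untopD_mem v hi) (gaussVal_untopD_mem v hj), ?_⟩
    obtain ⟨k, rfl⟩ := Nat.exists_eq_add_of_le hij.le
    rw [add_smul] at heq
    rw [map_sub, Nat.add_sub_cancel_left, sub_eq_iff_eq_add]
    refine add_right_cancel (b := i • μ) (heq.trans ?_)
    abel
  exact (Nat.mul_le_mul_right _ (hle.trans (Nat.sub_le j i))).trans
    (mul_natDegree_le_of_expCoeff_ne_zero hφ.monic hj)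

end Polygon

end KrullNewton

/-! ### The factor of large degree. -/

theorem mainTheorem1 {K G : Type*} [Field K] [AddCommGroup G] [LinearOrder G]
    [IsOrderedAddMonoid G] (v : AddValuation K (WithTop G))
    (φ f : (KrullNewton.valuationRing v)[X]) (m : ℕ)
    (hφ_monic : φ.Monic) (hφ_deg : φ.natDegree = m)
    (hφ_irr : Irreducible
      (φ.map (IsLocalRing.residue (KrullNewton.valuationRing v))))
    (n : ℕ) (a : ℕ → K[X])
    (ha : KrullNewton.IsExpansion
      (φ.map (algebraMap (KrullNewton.valuationRing v) K))
      (f.map (algebraMap (KrullNewton.valuationRing v) K)) n a)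
    (ha0 : KrullNewton.gaussVal v (a 0) ≠ 0)
    (s : ℕ) (hs : IsLeast {j | j ≤ n ∧ KrullNewton.gaussVal v (a j) = 0} s)
    (hlow : ∃ i < s, a i ≠ 0)
    (l : ℕ) (slopes : Fin l → DivisibleHull G) (hslopes_anti : StrictAnti slopes)
    (hslopes : Set.range slopes = {μ | KrullNewton.IsPolygonSlope v n a μ ∧ 0 < μ})
    (d : Fin l → ℕ)
    (hd : ∀ j, IsLeast
      {e : ℕ | 0 < e ∧ e • slopes j ∈
        (KrullNewton.valueGroup v).map (DivisibleHull.coeAddMonoidHom G)} (d j)) :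
    ∃ g : K[X], Irreducible g ∧
      g ∣ f.map (algebraMap (KrullNewton.valuationRing v) K) ∧
      (Finset.univ.sup fun j => d j * m) ≤ g.natDegree := by
  have hkey := KrullNewton.isKeyFor_hullVal v hφ_monic hφ_irr
  have hcoeff : KrullNewton.expCoeff (φ.map (algebraMap (KrullNewton.valuationRing v) K)) n
      (f.map (algebraMap (KrullNewton.valuationRing v) K)) ≠ 0 := by
    rw [ha.expCoeff_eq hkey.monic, if_pos le_rfl]
    exact ha.leading_ne_zero
  have hf0 : f.map (algebraMap (KrullNewton.valuationRing v) K) ≠ 0 := by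
    intro h
    rw [h, KrullNewton.expCoeff_zero] at hcoeff
    exact hcoeff rfl
  rcases isEmpty_or_nonempty (Fin l) with hl | hl
  -- With an empty family of slopes the supremum is `0`, and any irreducible factor serves; `n > 0`
  -- ensures that `f` is not a unit.
  · have hn : 0 < n := by
      obtain ⟨i, hi, -⟩ := hlow
      exact (Nat.zero_le i).trans_lt (hi.trans_le hs.1.1)
    have hdeg := KrullNewton.mul_natDegree_le_of_expCoeff_ne_zero hkey.monic hcoeff
    obtain ⟨g, hg, hgf⟩ := WfDvdMonoid.exists_irreducible_factor
      (fun hu => absurd (natDegree_eq_zero_of_isUnit hu)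
        ((Nat.mul_pos hn hkey.natDegree_pos).trans_le hdeg).ne') hf0
    exact ⟨g, hg, hgf, by simp⟩
  -- One slope attaining the maximum suffices.
  · obtain ⟨j, -, hj⟩ := Finset.exists_mem_eq_sup Finset.univ Finset.univ_nonempty
      fun j => d j * m
    obtain ⟨hslope, hpos⟩ : slopes j ∈ {μ | KrullNewton.IsPolygonSlope v n a μ ∧ 0 < μ} :=
      hslopes ▸ Set.mem_range_self j
    obtain ⟨g, hg, hgf, hnd⟩ : ∃ g, Irreducible g ∧
        g ∣ f.map (algebraMap (KrullNewton.valuationRing v) K) ∧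
        ¬ KrullNewton.HasDominantTerm (φ.map (algebraMap (KrullNewton.valuationRing v) K))
          (KrullNewton.hullVal v) (slopes j) g := by
      by_contra! hcon
      exact ha.not_hasDominantTerm hkey hslope
        (hkey.hasDominantTerm_of_irreducible_factors hpos hf0 hcon)
    refine ⟨g, hg, hgf, ?_⟩
    have := KrullNewton.mul_natDegree_le_of_not_hasDominantTerm hkey hg.ne_zero hnd (hd j).2
    rwa [hφ_monic.natDegree_map, hφ_deg, ← hj] at this
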